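/- For a locally compact second countable (Hausdorff) group $G$ with left Haar measure, let $\lambda_s\xi(g)=\xi(s^{-1}g)$ ($s\in G$, $\xi\in L^2(G)$) be the left regular representation on $L^2(G)$. For a complex Borel measure $\mu$ on $G$ let $\lambda(\mu)$ be the bounded operator $\lambda(\mu)\xi=\int_G\lambda_s\xi\,d\mu(s)$ on $L^2(G)$, and for $f\in L^1(G)$ let $\lambda(f)\xi=\int_G f(s)\,\lambda_s\xi\,ds$. Let $C^*_r(G)$ be the operator-norm closure of $\{\lambda(f): f\in L^1(G)\}$. For a closed set $E\subseteq G$ let $M(E)$ be the set of complex Borel measures on $G$ whose support is contained in $E$. A closed set $E\subseteq G$ is a *set of extended uniqueness* if $\lambda(M(E))\cap C^*_r(G)=\{0\}$, and an *$M_0$-set* if it is closed and not a set of extended uniqueness. **Theorem.** Let $G$ be a locally compact second countable Hausdorff group which is abelian or compact, let $H$ be a closed normal subgroup of $G$ with quotient map $q:G\to G/H$, and let $E\subseteq G/H$ be a closed set. If $q^{-1}(E)$ is an $M_0$-set in $G$, then $E$ is an $M_0$-set in $G/H$. -/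

import Mathlib

open MeasureTheory
open scoped ENNReal

/-- A complex measure has finite total variation. -/
theorem ComplexMeasure.isFiniteMeasure_variation {X : Type*} [MeasurableSpace X]
    (μ : ComplexMeasure X) : IsFiniteMeasure μ.variation := by
  have hle : μ.variation ≤ (ComplexMeasure.re μ).totalVariation +
      (ComplexMeasure.im μ).totalVariation := by
    apply VectorMeasure.variation_le_of_forall_enorm_le
    intro A _
    have h1 : ‖μ A‖ₑ ≤ ‖ComplexMeasure.re μ A‖ₑ + ‖ComplexMeasure.im μ A‖ₑ := by
      have h2 : ‖μ A‖ ≤ ‖(μ A).re‖ + ‖(μ A).im‖ := Complex.norm_le_abs_re_add_abs_im (μ A)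
      have h3 := ENNReal.ofReal_le_ofReal h2
      rw [ENNReal.ofReal_add (norm_nonneg _) (norm_nonneg _), ofReal_norm, ofReal_norm,
        ofReal_norm] at h3
      exact h3
    exact h1.trans (add_le_add (SignedMeasure.enorm_le_totalVariation _ _)
      (SignedMeasure.enorm_le_totalVariation _ _))
  exact isFiniteMeasure_of_le _ hle

namespace HarmonicAnalysis

noncomputable section

/-! ### The left regular representation

`G` is a locally compact second countable group with its Borel `σ`-algebra and a (left) Haar
measure. -/

section Regular

variable (G : Type*) [Group G] [TopologicalSpace G] [IsTopologicalGroup G]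
  [LocallyCompactSpace G] [MeasurableSpace G] [BorelSpace G]

/-- The Hilbert space `L²(G)` of the left Haar measure. -/
abbrev L2 : Type _ := Lp ℂ 2 (Measure.haar : Measure G)

variable {G}

/-- The left regular representation on `L²(G)`: `(λ_s ξ)(g) = ξ(s⁻¹ g)`. -/
def leftRegular (s : G) : L2 G →ₗᵢ[ℂ] L2 G :=
  Lp.compMeasurePreservingₗᵢ ℂ (fun g : G => s⁻¹ * g) (measurePreserving_mul_left Measure.haar s⁻¹)

theorem leftRegular_coeFn (s : G) (ξ : L2 G) :
    leftRegular s ξ =ᵐ[Measure.haar] fun g => ξ (s⁻¹ * g) :=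
  Lp.coeFn_compMeasurePreserving ξ (measurePreserving_mul_left Measure.haar s⁻¹)

theorem continuous_leftRegular (ξ : L2 G) : Continuous fun s : G => leftRegular s ξ := by
  have : Fact ((2 : ℝ≥0∞) ≠ ∞) := ⟨by norm_num⟩
  have h : Continuous fun s : G => (DomMulAct.mk s⁻¹ • ξ : L2 G) :=
    (DomMulAct.continuous_mk.comp continuous_inv).smul continuous_const
  exact h

variable [SecondCountableTopology G]

theorem aestronglyMeasurable_leftRegular (ξ : L2 G) (ν : Measure G) :
    AEStronglyMeasurable (fun s : G => leftRegular s ξ) ν :=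
  (continuous_leftRegular ξ).aestronglyMeasurable

theorem integrable_leftRegular (μ : ComplexMeasure G) (ξ : L2 G) :
    μ.Integrable fun s : G => leftRegular s ξ := by
  have := ComplexMeasure.isFiniteMeasure_variation μ
  exact Integrable.of_bound (aestronglyMeasurable_leftRegular ξ _) ‖ξ‖
    (Filter.Eventually.of_forall fun s => by simp)

variable (G) in
/-- The pairing `(ξ, z) ↦ z • ξ` between vectors and scalars, used to integrate `L²(G)`-valued
functions against complex measures. -/
def smulPairing : L2 G →L[ℝ] ℂ →L[ℝ] L2 G :=
  (ContinuousLinearMap.lsmul ℝ ℂ).flip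

/-- The operator `λ(μ)` on `L²(G)` for a complex Borel measure `μ` on `G`:
`λ(μ) ξ = ∫ λ_s ξ dμ(s)`. -/
def leftRegularMeasure (μ : ComplexMeasure G) : L2 G →L[ℂ] L2 G :=
  LinearMap.mkContinuous
    { toFun := fun ξ => VectorMeasure.integral μ (fun s => leftRegular s ξ) (smulPairing G)
      map_add' := fun ξ η => by
        simp only [map_add]
        exact VectorMeasure.integral_fun_add (integrable_leftRegular μ ξ)
          (integrable_leftRegular μ η)
      map_smul' := fun c ξ => by
        simp only [map_smul, RingHom.id_apply]
        exact setToFun_smul _ (fun z A x => smul_comm (μ A) z x) c _ }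
    (‖smulPairing G‖ * μ.variation.real Set.univ) (fun ξ => by
      have := ComplexMeasure.isFiniteMeasure_variation μ
      have h := VectorMeasure.norm_integral_le_integral_norm (μ := μ) (B := smulPairing G)
        (f := fun s => leftRegular s ξ)
      simpa [mul_assoc] using h)

theorem leftRegularMeasure_apply (μ : ComplexMeasure G) (ξ : L2 G) :
    leftRegularMeasure μ ξ =
      VectorMeasure.integral μ (fun s => leftRegular s ξ) (smulPairing G) := rfl

theorem integrable_smul_leftRegular (f : Lp ℂ 1 (Measure.haar : Measure G)) (ξ : L2 G) :
    Integrable (fun s : G => f s • leftRegular s ξ) Measure.haar := by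
  have hf : Integrable f (Measure.haar : Measure G) := L1.integrable_coeFn f
  refine (hf.norm.mul_const ‖ξ‖).mono'
    (hf.aestronglyMeasurable.smul (aestronglyMeasurable_leftRegular ξ _))
    (Filter.Eventually.of_forall fun s => ?_)
  simp [norm_smul]

/-- The operator `λ(f)` on `L²(G)` for `f ∈ L¹(G)`: `λ(f) ξ = ∫ f(s) λ_s ξ ds`. -/
def leftRegularL1 (f : Lp ℂ 1 (Measure.haar : Measure G)) : L2 G →L[ℂ] L2 G :=
  LinearMap.mkContinuous
    { toFun := fun ξ => ∫ s, f s • leftRegular s ξ ∂Measure.haar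
      map_add' := fun ξ η => by
        simp only [map_add, smul_add]
        exact integral_add (integrable_smul_leftRegular f ξ) (integrable_smul_leftRegular f η)
      map_smul' := fun c ξ => by
        simp only [map_smul, RingHom.id_apply]
        rw [← integral_smul]
        exact integral_congr_ae (Filter.Eventually.of_forall fun s => smul_comm _ _ _) }
    (∫ s, ‖f s‖ ∂Measure.haar) (fun ξ => by
      refine (norm_integral_le_integral_norm _).trans (le_of_eq ?_)
      rw [← integral_mul_const]
      simp [norm_smul])

theorem leftRegularL1_apply (f : Lp ℂ 1 (Measure.haar : Measure G)) (ξ : L2 G) :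
    leftRegularL1 f ξ = ∫ s, f s • leftRegular s ξ ∂Measure.haar := rfl

variable (G) in
/-- The reduced group `C*`-algebra `C*_r(G)`, as a set of operators on `L²(G)`: the operator norm
closure of `{λ(f) : f ∈ L¹(G)}`. -/
def reducedCStar : Set (L2 G →L[ℂ] L2 G) :=
  closure (Set.range (leftRegularL1 : Lp ℂ 1 (Measure.haar : Measure G) → L2 G →L[ℂ] L2 G))

/-- The set `M(E)` of the complex Borel measures on `G` whose support (the support of the total
variation) is contained in `E`. -/
def measuresOn (E : Set G) : Set (ComplexMeasure G) :=
  {μ | μ.variation.support ⊆ E}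

/-- The condition `λ(M(E)) ∩ C*_r(G) = {0}`. -/
def MeetsTrivially (E : Set G) : Prop :=
  leftRegularMeasure '' measuresOn E ∩ reducedCStar G = {0}

end Regular

/-! ### Sets of extended uniqueness and `M₀`-sets

These are notions of topological groups: the `σ`-algebra is the Borel one. -/

section Sets

variable {G : Type*} [Group G] [TopologicalSpace G] [IsTopologicalGroup G]
  [LocallyCompactSpace G] [SecondCountableTopology G]

/-- A closed set `E ⊆ G` is a set of extended uniqueness if `λ(M(E)) ∩ C*_r(G) = {0}`. -/
def IsExtendedUniquenessSet (E : Set G) : Prop :=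
  IsClosed E ∧
    letI : MeasurableSpace G := borel G
    haveI : BorelSpace G := ⟨rfl⟩
    MeetsTrivially E

/-- An `M₀`-set (set of restricted multiplicity) is a closed set which is not a set of extended
uniqueness. -/
def IsM0Set (E : Set G) : Prop :=
  IsClosed E ∧ ¬ IsExtendedUniquenessSet E

end Sets

end

end HarmonicAnalysis

open Filter Topology
open scoped InnerProductSpace ComplexConjugate

/-! ### Complex measures with a density, and integrals against them -/

namespace ComplexMeasure

/-! Write `Q = G/H` and argue by contraposition. Let `μ` be carried by the preimage of `E`, with
`λ(μ)` a nonzero element of `C*_r(G)`. Some coefficient `u(s) = ⟨η, λ_s ξ⟩`, with `ξ`, `η`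
continuous of compact support, has `∫ u dμ ≠ 0`. The measure `ν = q_*(uμ)` lives on `E` and has
nonzero total mass, so `λ(ν) ≠ 0` (`integral_eq_zero_of_integral_smul_leftRegular`).

It remains to see that `λ(ν) ∈ C*_r(Q)`. By Fell absorption, `λ_G ⊗ (λ_Q ∘ q)` is a multiple of
`λ_G`, so `λ(μ) ↦ λ(q_*(uμ))` is bounded in operator norm. Concretely, the vectors `ξ_y(x) = ξ(x)
f(q(x)y)` satisfy `∫ ⟨η_y, λ_s ξ_y⟩ dy = u(s) ⟨g, λ_{q(s)} f⟩` and `∫ ‖ξ_y‖² dy = ‖ξ‖² ‖f‖²`, which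
yields `norm_le_of_regularCoefficient`. The same map sends `λ(L¹(G))` into `λ(L¹(Q))`, because Haar
measure pushes forward to an absolutely continuous measure (`exists_leftRegularL1_eq_map`); hence it
respects the closures. -/

theorem withDensityᵥ_rnDeriv_eq {X : Type*} [MeasurableSpace X] (c : ComplexMeasure X)
    (m : Measure X) [SigmaFinite m] (h : c ≪ᵥ m.toENNRealVectorMeasure) :
    m.withDensityᵥ (MeasureTheory.ComplexMeasure.rnDeriv c m) = c := by
  rw [MeasureTheory.ComplexMeasure.absolutelyContinuous_ennreal_iff] at h
  have h1 := SignedMeasure.withDensityᵥ_rnDeriv_eq _ m h.1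
  have h2 := SignedMeasure.withDensityᵥ_rnDeriv_eq _ m h.2
  have hint := MeasureTheory.ComplexMeasure.integrable_rnDeriv c m
  ext i hi : 1
  rw [withDensityᵥ_apply hint hi]
  apply Complex.ext
  · rw [← RCLike.re_eq_complex_re, ← integral_re hint.integrableOn]
    have := congrArg (fun v => v i) h1
    simp only [withDensityᵥ_apply (SignedMeasure.integrable_rnDeriv _ _) hi] at this
    exact this
  · rw [← RCLike.im_eq_complex_im, ← integral_im hint.integrableOn]
    have := congrArg (fun v => v i) h2
    simp only [withDensityᵥ_apply (SignedMeasure.integrable_rnDeriv _ _) hi] at this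
    exact this

end ComplexMeasure

namespace HarmonicAnalysis

/-- Turns integrals against a complex measure into Bochner integrals, to which Fubini applies. Both
sides are continuous in `F` for the `L¹` norm of the variation, so indicators suffice. -/
theorem integral_withDensityᵥ {X V : Type*} [MeasurableSpace X] [NormedAddCommGroup V]
    [NormedSpace ℂ V] [CompleteSpace V] {m : Measure X} {k : X → ℂ} (hk : Integrable k m)
    {F : X → V} (hF : Integrable F (m.withDensityᵥ k).variation) :
    VectorMeasure.integral (m.withDensityᵥ k) F
      (ContinuousLinearMap.lsmul ℝ ℂ : ℂ →L[ℝ] V →L[ℝ] V).flip = ∫ x, k x • F x ∂m := by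
  have hvar : (m.withDensityᵥ k).variation = m.withDensity fun x => ‖k x‖ₑ :=
    Measure.variation_withDensityᵥ hk
  have hke : AEMeasurable (fun x => ‖k x‖ₑ) m := hk.aestronglyMeasurable.enorm
  have hlin : ∀ f : X → V, Integrable f (m.withDensityᵥ k).variation →
      Integrable (fun x => k x • f x) m := by
    intro f hf
    rw [hvar] at hf
    have h2 : Integrable (fun x => ‖k x‖ • f x) m := by
      have := (integrable_withDensity_iff_integrable_smul₀' (f := fun x => ‖k x‖ₑ) (g := f) hke
        (Filter.Eventually.of_forall fun x => by simp)).1 hf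
      simpa using this
    -- `F` is controlled only where `k ≠ 0`, so measurability comes from `‖k‖ • F` times the phase
    -- `k/‖k‖`, which is `0` where `k = 0`.
    have h3 : AEStronglyMeasurable (fun x => (k x * (‖k x‖⁻¹ : ℝ)) • (‖k x‖ • f x)) m :=
      (hk.aestronglyMeasurable.mul
        (Complex.continuous_ofReal.comp_aestronglyMeasurable
          hk.aestronglyMeasurable.norm.inv₀)).smul h2.aestronglyMeasurable
    have h4 : (fun x => (k x * (‖k x‖⁻¹ : ℝ)) • (‖k x‖ • f x)) = fun x => k x • f x := by
      funext x
      by_cases hx : k x = 0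
      · simp [hx]
      · have : (‖k x‖ : ℂ) ≠ 0 := by simpa using hx
        rw [← Complex.coe_smul ‖k x‖ (f x), smul_smul]
        congr 1
        push_cast
        field_simp
    rw [h4] at h3
    exact h2.mono h3 (Filter.Eventually.of_forall fun x => by simp [norm_smul])
  have hbound : ∀ f : X → V, Integrable f (m.withDensityᵥ k).variation →
      ‖∫ x, k x • f x ∂m‖ₑ ≤ ∫⁻ x, ‖f x‖ₑ ∂(m.withDensityᵥ k).variation := by
    intro f hf
    rw [hvar] at hf
    refine (enorm_integral_le_lintegral_enorm _).trans ?_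
    rw [hvar]
    refine le_trans (le_of_eq ?_) (lintegral_withDensity_eq_lintegral_mul₀' hke ?_).ge
    · simp [enorm_smul]
    · exact hf.aestronglyMeasurable.enorm
  refine Integrable.induction (P := fun F => VectorMeasure.integral (m.withDensityᵥ k) F
      (ContinuousLinearMap.lsmul ℝ ℂ : ℂ →L[ℝ] V →L[ℝ] V).flip = ∫ x, k x • F x ∂m)
      ?_ ?_ ?_ ?_ hF
  · intro c s hs hfin
    rw [VectorMeasure.integral_eq_setToFun, setToFun_indicator_const _ hs hfin.ne,
      transpose_eq_cbmApplyMeasure, cbmApplyMeasure_apply, withDensityᵥ_apply hk hs]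
    simp only [ContinuousLinearMap.flip_apply, ContinuousLinearMap.lsmul_apply]
    rw [← integral_smul_const, ← integral_indicator hs]
    refine integral_congr_ae (Filter.Eventually.of_forall fun x => ?_)
    by_cases hx : x ∈ s <;> simp [hx]
  · intro f g _ hf hg h1 h2
    rw [VectorMeasure.integral_add hf hg, h1, h2, ← integral_add (hlin f hf) (hlin g hg)]
    simp
  · refine isClosed_eq VectorMeasure.continuous_integral ?_
    refine (LipschitzWith.of_edist_le fun u v => ?_).continuous
    have hu := L1.integrable_coeFn u
    have hv := L1.integrable_coeFn v
    rw [edist_eq_enorm_sub, ← integral_sub (hlin _ hu) (hlin _ hv), Lp.edist_def,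
      eLpNorm_one_eq_lintegral_enorm]
    simpa [smul_sub] using hbound _ (hu.sub hv)
  · intro f g hfg hf h
    rw [← VectorMeasure.integral_congr_ae hfg, h]
    rw [hvar] at hfg
    have := (ae_withDensity_iff' hke).1 hfg
    refine integral_congr_ae (this.mono fun x hx => ?_)
    by_cases hx0 : k x = 0
    · simp [hx0]
    · have h := hx (by simpa using hx0)
      simp [h]

/-! ### Compactly supported vectors and operators of pushed-forward densities -/

section

variable {G : Type*} [Group G] [TopologicalSpace G] [IsTopologicalGroup G]
  [LocallyCompactSpace G] [MeasurableSpace G] [BorelSpace G]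

/-- A compactly supported continuous function as a vector of `L²(G)`. -/
noncomputable def vectorOfCompactSupport (f : G → ℂ) (hf : Continuous f)
    (hc : HasCompactSupport f) : L2 G :=
  (hf.memLp_of_hasCompactSupport (p := 2) (μ := Measure.haar) hc).toLp f

theorem vectorOfCompactSupport_coeFn (f : G → ℂ) (hf : Continuous f) (hc : HasCompactSupport f) :
    vectorOfCompactSupport f hf hc =ᵐ[Measure.haar] f :=
  MemLp.coeFn_toLp _

variable [SecondCountableTopology G]

variable (G) in
/-- The compactly supported continuous vectors of `L²(G)`. -/
def compactlySupportedVectors : Set (L2 G) :=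
  {ξ | ∃ (f : G → ℂ) (hf : Continuous f) (hc : HasCompactSupport f),
    vectorOfCompactSupport f hf hc = ξ}

theorem dense_compactlySupportedVectors : Dense (compactlySupportedVectors G) := by
  intro ξ
  rw [EMetric.mem_closure_iff]
  intro ε hε
  obtain ⟨δ, hδ, hδε⟩ := exists_between hε
  obtain ⟨g, hgc, hle, hg, hgL⟩ :=
    (Lp.memLp ξ).exists_hasCompactSupport_eLpNorm_sub_le (by norm_num) hδ.ne'
  refine ⟨_, ⟨g, hg, hgc, rfl⟩, lt_of_le_of_lt ?_ hδε⟩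
  rw [Lp.edist_def]
  refine le_trans (le_of_eq (eLpNorm_congr_ae ?_)) hle
  filter_upwards [vectorOfCompactSupport_coeFn g hg hgc] with x hx
  simp [hx]

theorem integrable_smul_leftRegular_comp {X : Type*} [MeasurableSpace X] {m : Measure X}
    {k : X → ℂ} (hk : Integrable k m) {p : X → G} (hp : Measurable p) (ξ : L2 G) :
    Integrable (fun x => k x • leftRegular (p x) ξ) m := by
  refine (hk.norm.mul_const ‖ξ‖).mono' (hk.aestronglyMeasurable.smul ?_)
    (Filter.Eventually.of_forall fun x => by simp [norm_smul])
  exact ((continuous_leftRegular ξ).stronglyMeasurable.comp_measurable hp).aestronglyMeasurable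

theorem leftRegularMeasure_map_withDensityᵥ {X : Type*} [MeasurableSpace X] {m : Measure X}
    {k : X → ℂ} (hk : Integrable k m) {p : X → G} (hp : Measurable p) (ξ : L2 G) :
    leftRegularMeasure ((m.withDensityᵥ k).map p) ξ = ∫ x, k x • leftRegular (p x) ξ ∂m := by
  have hfin : IsFiniteMeasure (m.withDensityᵥ k).variation :=
    ComplexMeasure.isFiniteMeasure_variation _
  have hint : (m.withDensityᵥ k).Integrable fun x => leftRegular (p x) ξ :=
    Integrable.of_bound
      ((continuous_leftRegular ξ).stronglyMeasurable.comp_measurable hp).aestronglyMeasurable ‖ξ‖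
      (Filter.Eventually.of_forall fun s => by simp)
  rw [leftRegularMeasure_apply, VectorMeasure.integral_map hp
    (aestronglyMeasurable_leftRegular ξ _) hint]
  exact integral_withDensityᵥ hk hint

theorem leftRegularMeasure_withDensityᵥ {m : Measure G}
    {k : G → ℂ} (hk : Integrable k m) (ξ : L2 G) :
    leftRegularMeasure (m.withDensityᵥ k) ξ = ∫ x, k x • leftRegular x ξ ∂m := by
  have := leftRegularMeasure_map_withDensityᵥ hk measurable_id ξ
  rwa [VectorMeasure.map_id] at this

end

/-! ### Pushing `L¹` forward along the quotient map -/

section Quotient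

variable {G Q : Type*} [Group G] [TopologicalSpace G] [IsTopologicalGroup G]
  [LocallyCompactSpace G] [MeasurableSpace G] [BorelSpace G] [SecondCountableTopology G]
  [Group Q] [TopologicalSpace Q] [IsTopologicalGroup Q]
  [LocallyCompactSpace Q] [MeasurableSpace Q] [BorelSpace Q] [SecondCountableTopology Q]

/-- For null `N`, the set of `(x, y)` with `q x * y ∈ N` is null, its slices at fixed `x` being left
translates of `N`. So some slice at fixed `y = q z` is null; it is a right translate of `q⁻¹(N)`,
and right translation preserves Haar null sets. -/
theorem map_haar_absolutelyContinuous {q : G →* Q} (hq : Continuous q)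
    (hs : Function.Surjective q) :
    (Measure.haar : Measure G).map q ≪ (Measure.haar : Measure Q) := by
  refine Measure.AbsolutelyContinuous.mk fun N hN h0 => ?_
  rw [Measure.map_apply hq.measurable hN]
  have hmeas : Measurable fun z : G × Q => q z.1 * z.2 :=
    (hq.measurable.comp measurable_fst).mul measurable_snd
  have hA : MeasurableSet {z : G × Q | q z.1 * z.2 ∈ N} := hmeas hN
  have h1 : ((Measure.haar : Measure G).prod (Measure.haar : Measure Q))
      {z : G × Q | q z.1 * z.2 ∈ N} = 0 := by
    rw [Measure.measure_prod_null hA]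
    refine Filter.Eventually.of_forall fun x => ?_
    have : Prod.mk x ⁻¹' {z : G × Q | q z.1 * z.2 ∈ N} = (fun y => q x * y) ⁻¹' N := rfl
    simp only [this, measure_preimage_mul, h0, Pi.zero_apply]
  have h2 := Measure.ae_ae_of_ae_prod (μ := (Measure.haar : Measure Q))
    (ν := (Measure.haar : Measure G)) (p := fun z => q z.2 * z.1 ∉ N) (by
      rw [← Measure.prod_swap] at h1
      rw [Measure.map_apply measurable_swap hA] at h1
      rw [ae_iff]
      simpa using h1)
  obtain ⟨y, hy⟩ := h2.exists
  obtain ⟨z, rfl⟩ := hs y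
  have h3 : (Measure.haar : Measure G) ((fun x => x * z) ⁻¹' (q ⁻¹' N)) = 0 := by
    rw [ae_iff] at hy
    simpa [Set.preimage, map_mul] using hy
  rwa [measure_mul_right_null] at h3

theorem exists_leftRegularL1_eq_map {q : G →* Q} (hq : Continuous q)
    (hs : Function.Surjective q) {k : G → ℂ} (hk : Integrable k (Measure.haar : Measure G)) :
    ∃ F : Lp ℂ 1 (Measure.haar : Measure Q), ∀ ξ : L2 Q,
      leftRegularL1 F ξ = ∫ x, k x • leftRegular (q x) ξ ∂Measure.haar := by
  set ν : ComplexMeasure Q := ((Measure.haar : Measure G).withDensityᵥ k).map q with hν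
  have hac : ν ≪ᵥ (Measure.haar : Measure Q).toENNRealVectorMeasure := by
    refine VectorMeasure.AbsolutelyContinuous.mk fun A hA h0 => ?_
    rw [Measure.toENNRealVectorMeasure_apply_measurable hA] at h0
    have h1 := map_haar_absolutelyContinuous hq hs h0
    rw [Measure.map_apply hq.measurable hA] at h1
    rw [hν, VectorMeasure.map_apply _ hq.measurable hA,
      withDensityᵥ_apply hk (hq.measurable hA), setIntegral_measure_zero _ h1]
  have hd := ComplexMeasure.withDensityᵥ_rnDeriv_eq ν Measure.haar hac
  have hint := MeasureTheory.ComplexMeasure.integrable_rnDeriv ν (Measure.haar : Measure Q)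
  refine ⟨hint.toL1 _, fun ξ => ?_⟩
  rw [← leftRegularMeasure_map_withDensityᵥ hk hq.measurable, ← hν, leftRegularL1_apply]
  conv_rhs => rw [← hd]
  rw [leftRegularMeasure_withDensityᵥ hint]
  refine integral_congr_ae ?_
  filter_upwards [hint.coeFn_toL1] with x hx
  rw [hx]

end Quotient

/-! ### Inner products of compactly supported vectors -/

section

variable {G : Type*} [Group G] [TopologicalSpace G] [IsTopologicalGroup G]
  [LocallyCompactSpace G] [MeasurableSpace G] [BorelSpace G]

theorem leftRegular_vectorOfCompactSupport (s : G) (f : G → ℂ) (hf : Continuous f)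
    (hc : HasCompactSupport f) :
    leftRegular s (vectorOfCompactSupport f hf hc) =ᵐ[Measure.haar] fun x => f (s⁻¹ * x) := by
  have h := (measurePreserving_mul_left (Measure.haar : Measure G) s⁻¹).quasiMeasurePreserving.ae
    (vectorOfCompactSupport_coeFn f hf hc)
  filter_upwards [h, leftRegular_coeFn s (vectorOfCompactSupport f hf hc)] with x h1 h2
  rw [h2, h1]

theorem inner_leftRegular_vectorOfCompactSupport (s : G) (f g : G → ℂ) (hf : Continuous f)
    (hfc : HasCompactSupport f) (hg : Continuous g) (hgc : HasCompactSupport g) :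
    ⟪vectorOfCompactSupport g hg hgc, leftRegular s (vectorOfCompactSupport f hf hfc)⟫_ℂ =
      ∫ x, conj (g x) * f (s⁻¹ * x) ∂Measure.haar := by
  rw [L2.inner_def]
  refine integral_congr_ae ?_
  filter_upwards [vectorOfCompactSupport_coeFn g hg hgc,
    leftRegular_vectorOfCompactSupport s f hf hfc] with x h1 h2
  rw [h1, h2, RCLike.inner_apply, mul_comm]

theorem norm_sq_vectorOfCompactSupport (f : G → ℂ) (hf : Continuous f)
    (hc : HasCompactSupport f) :
    ‖vectorOfCompactSupport f hf hc‖ ^ 2 = ∫ x, ‖f x‖ ^ 2 ∂Measure.haar := by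
  rw [← inner_self_eq_norm_sq (𝕜 := ℂ), L2.inner_def, ← integral_re (L2.integrable_inner _ _)]
  refine integral_congr_ae ?_
  filter_upwards [vectorOfCompactSupport_coeFn f hf hc] with x h1
  rw [h1, inner_self_eq_norm_sq (𝕜 := ℂ)]

end

/-! ### Fell absorption through fibre vectors -/

section Quotient

variable {G Q : Type*} [Group G] [TopologicalSpace G] [IsTopologicalGroup G]
  [LocallyCompactSpace G] [MeasurableSpace G] [BorelSpace G] [SecondCountableTopology G]
  [Group Q] [TopologicalSpace Q] [IsTopologicalGroup Q]
  [LocallyCompactSpace Q] [MeasurableSpace Q] [BorelSpace Q] [SecondCountableTopology Q]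

omit [LocallyCompactSpace G] [MeasurableSpace G] [BorelSpace G] [SecondCountableTopology G]
  [LocallyCompactSpace Q] [MeasurableSpace Q] [BorelSpace Q] [SecondCountableTopology Q] in
theorem hasCompactSupport_mul_comp_mul {q : G →* Q} (hq : Continuous q) {ξ : G → ℂ} {f : Q → ℂ}
    (hξ : HasCompactSupport ξ) (hf : HasCompactSupport f) :
    HasCompactSupport fun z : G × Q => ξ z.1 * f (q z.1 * z.2) := by
  have hcont : Continuous fun z : G × Q => (z.1, (q z.1)⁻¹ * z.2) := by fun_prop
  -- No separation is assumed, so the compact image is replaced by its closure.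
  refine HasCompactSupport.intro' ((hξ.isCompact.prod hf.isCompact).image hcont).closure
    isClosed_closure fun z hz => ?_
  by_contra h
  refine hz (subset_closure ⟨(z.1, q z.1 * z.2), ⟨?_, ?_⟩, by simp⟩)
  · exact subset_tsupport _ (left_ne_zero_of_mul h)
  · exact subset_tsupport _ (right_ne_zero_of_mul h)

/-- The vector `x ↦ ξ x * f (q x * y)` of `L²(G)`. -/
noncomputable def fiberVector {q : G →* Q} (hq : Continuous q) {ξ : G → ℂ} {f : Q → ℂ}
    (hξ : Continuous ξ) (hξc : HasCompactSupport ξ) (hf : Continuous f) (y : Q) : L2 G :=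
  vectorOfCompactSupport (fun x => ξ x * f (q x * y)) (by fun_prop) hξc.mul_right

variable {q : G →* Q} (hq : Continuous q) {ξ η : G → ℂ} {f g : Q → ℂ}
    (hξ : Continuous ξ) (hξc : HasCompactSupport ξ) (hη : Continuous η) (hηc : HasCompactSupport η)
    (hf : Continuous f) (hfc : HasCompactSupport f) (hg : Continuous g) (hgc : HasCompactSupport g)

include hfc in
theorem integrable_norm_sq_fiberVector :
    Integrable (fun y => ‖fiberVector hq hξ hξc hf y‖ ^ 2) Measure.haar ∧
      ∫ y, ‖fiberVector hq hξ hξc hf y‖ ^ 2 ∂Measure.haar =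
        ‖vectorOfCompactSupport ξ hξ hξc‖ ^ 2 * ‖vectorOfCompactSupport f hf hfc‖ ^ 2 := by
  have hΦ := hasCompactSupport_mul_comp_mul hq hξc hfc
  have hΦc : Continuous fun z : G × Q => ξ z.1 * f (q z.1 * z.2) := by fun_prop
  have hint : Integrable (fun z : G × Q => ‖ξ z.1 * f (q z.1 * z.2)‖ ^ 2)
      ((Measure.haar : Measure G).prod (Measure.haar : Measure Q)) := by
    refine Continuous.integrable_of_hasCompactSupport (by fun_prop) ?_
    exact hΦ.comp_left (g := fun w : ℂ => ‖w‖ ^ 2) (by simp)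
  simp only [fiberVector, norm_sq_vectorOfCompactSupport]
  refine ⟨hint.integral_prod_right, ?_⟩
  rw [integral_integral_swap (f := fun (y : Q) (x : G) => ‖ξ x * f (q x * y)‖ ^ 2) hint.swap]
  simp only [norm_mul, mul_pow, integral_const_mul]
  rw [← integral_mul_const]
  refine integral_congr_ae (Filter.Eventually.of_forall fun x => ?_)
  simp only
  rw [integral_mul_left_eq_self (fun y => ‖f y‖ ^ 2)]

include hfc hgc in
-- After Fubini, the substitution `y ↦ (q x)⁻¹ * y` removes `x` from the integral over `Q`, and the
-- double integral factors.
theorem integral_inner_fiberVector (s : G) :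
    ∫ y, ⟪fiberVector hq hη hηc hg y, leftRegular s (fiberVector hq hξ hξc hf y)⟫_ℂ
        ∂(Measure.haar : Measure Q) =
      ⟪vectorOfCompactSupport η hη hηc, leftRegular s (vectorOfCompactSupport ξ hξ hξc)⟫_ℂ *
      ⟪vectorOfCompactSupport g hg hgc, leftRegular (q s) (vectorOfCompactSupport f hf hfc)⟫_ℂ := by
  simp only [fiberVector, inner_leftRegular_vectorOfCompactSupport]
  have hΨ := hasCompactSupport_mul_comp_mul hq hηc hgc
  have hint : Integrable (fun z : G × Q => conj (η z.1 * g (q z.1 * z.2)) *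
      (ξ (s⁻¹ * z.1) * f (q (s⁻¹ * z.1) * z.2)))
      ((Measure.haar : Measure G).prod (Measure.haar : Measure Q)) := by
    refine Continuous.integrable_of_hasCompactSupport (by fun_prop) (HasCompactSupport.mul_right ?_)
    exact hΨ.comp_left (g := fun w : ℂ => conj w) (by simp)
  rw [integral_integral_swap (f := fun (y : Q) (x : G) => conj (η x * g (q x * y)) *
      (ξ (s⁻¹ * x) * f (q (s⁻¹ * x) * y))) hint.swap, ← integral_mul_const]
  refine integral_congr_ae (Filter.Eventually.of_forall fun x => ?_)
  simp only
  rw [← integral_mul_left_eq_self (fun y => conj (g y) * f ((q s)⁻¹ * y)) (q x),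
    ← integral_const_mul]
  refine integral_congr_ae (Filter.Eventually.of_forall fun y => ?_)
  simp only [map_mul, map_inv, mul_assoc]
  ring

omit [LocallyCompactSpace Q] in
theorem stronglyMeasurable_inner_fiberVector :
    StronglyMeasurable fun z : G × Q =>
      ⟪fiberVector hq hη hηc hg z.2, leftRegular z.1 (fiberVector hq hξ hξc hf z.2)⟫_ℂ := by
  simp only [fiberVector, inner_leftRegular_vectorOfCompactSupport]
  refine StronglyMeasurable.integral_prod_right (f := fun (z : G × Q) (x : G) =>
    conj (η x * g (q x * z.2)) * (ξ (z.1⁻¹ * x) * f (q (z.1⁻¹ * x) * z.2))) ?_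
  exact Continuous.stronglyMeasurable (by unfold Function.uncurry; fun_prop)

include hfc hgc in
theorem integrable_inner_fiberVector {m : Measure G} [SFinite m] {k : G → ℂ}
    (hk : Integrable k m) :
    Integrable (fun z : G × Q => k z.1 *
      ⟪fiberVector hq hη hηc hg z.2, leftRegular z.1 (fiberVector hq hξ hξc hf z.2)⟫_ℂ)
      (m.prod Measure.haar) := by
  have hξi := (integrable_norm_sq_fiberVector hq hξ hξc hf hfc).1
  have hηi := (integrable_norm_sq_fiberVector hq hη hηc hg hgc).1
  refine (hk.norm.mul_prod (hξi.add hηi)).mono' (hk.aestronglyMeasurable.comp_fst.mul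
    (stronglyMeasurable_inner_fiberVector hq hξ hξc hη hηc hf hg).aestronglyMeasurable)
    (Filter.Eventually.of_forall fun z => ?_)
  rw [norm_mul]
  refine mul_le_mul_of_nonneg_left ((norm_inner_le_norm _ _).trans ?_) (norm_nonneg _)
  rw [LinearIsometry.norm_map, Pi.add_apply]
  nlinarith [sq_nonneg (‖fiberVector hq hξ hξc hf z.2‖ - ‖fiberVector hq hη hηc hg z.2‖),
    sq_nonneg ‖fiberVector hq hξ hξc hf z.2‖, sq_nonneg ‖fiberVector hq hη hηc hg z.2‖]

/-- The matrix coefficient `s ↦ ⟨λ_s ξ, η⟩` of the left regular representation. -/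
noncomputable def regularCoefficient (ξ η : L2 G) (s : G) : ℂ := ⟪η, leftRegular s ξ⟫_ℂ

omit [SecondCountableTopology G] in
theorem continuous_regularCoefficient (ξ η : L2 G) : Continuous (regularCoefficient ξ η) :=
  continuous_const.inner (continuous_leftRegular ξ)

omit [SecondCountableTopology G] in
theorem integrable_mul_regularCoefficient {m : Measure G} {k : G → ℂ} (hk : Integrable k m)
    (ξ η : L2 G) : Integrable (fun s => k s * regularCoefficient ξ η s) m := by
  refine hk.mul_bdd (c := ‖η‖ * ‖ξ‖)
    (continuous_regularCoefficient ξ η).aestronglyMeasurable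
    (Filter.Eventually.of_forall fun s => ?_)
  exact (norm_inner_le_norm _ _).trans (by simp)

include hfc hgc in
-- Integrates the absorption identity against `k`: coefficients of the operator on `L²(Q)` become
-- averages over `y` of coefficients of the operator on `L²(G)`.
theorem inner_integral_regularCoefficient {m : Measure G} [SFinite m] {k : G → ℂ}
    (hk : Integrable k m) :
    Integrable (fun y => ⟪fiberVector hq hη hηc hg y,
        ∫ s, k s • leftRegular s (fiberVector hq hξ hξc hf y) ∂m⟫_ℂ) (Measure.haar : Measure Q) ∧
      ∫ y, ⟪fiberVector hq hη hηc hg y,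
        ∫ s, k s • leftRegular s (fiberVector hq hξ hξc hf y) ∂m⟫_ℂ ∂(Measure.haar : Measure Q) =
      ⟪vectorOfCompactSupport g hg hgc,
        ∫ s, (k s * regularCoefficient (vectorOfCompactSupport ξ hξ hξc)
          (vectorOfCompactSupport η hη hηc) s) •
            leftRegular (q s) (vectorOfCompactSupport f hf hfc) ∂m⟫_ℂ := by
  have hint := integrable_inner_fiberVector hq hξ hξc hη hηc hf hfc hg hgc hk
  have hpt : ∀ y, ⟪fiberVector hq hη hηc hg y,
        ∫ s, k s • leftRegular s (fiberVector hq hξ hξc hf y) ∂m⟫_ℂ =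
      ∫ s, k s * ⟪fiberVector hq hη hηc hg y,
        leftRegular s (fiberVector hq hξ hξc hf y)⟫_ℂ ∂m := by
    intro y
    have h := integral_inner (𝕜 := ℂ) (integrable_smul_leftRegular_comp hk (p := fun s => s) measurable_id
      (fiberVector hq hξ hξc hf y)) (fiberVector hq hη hηc hg y)
    simpa only [inner_smul_right] using h.symm
  simp only [hpt]
  refine ⟨hint.integral_prod_right, ?_⟩
  rw [integral_integral_swap (f := fun (y : Q) (s : G) => k s * ⟪fiberVector hq hη hηc hg y,
        leftRegular s (fiberVector hq hξ hξc hf y)⟫_ℂ) hint.swap,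
    ← integral_inner (integrable_smul_leftRegular_comp
      (integrable_mul_regularCoefficient hk _ _) hq.measurable _)]
  refine integral_congr_ae (Filter.Eventually.of_forall fun s => ?_)
  simp only [integral_const_mul]
  rw [integral_inner_fiberVector hq hξ hξc hη hηc hf hfc hg hgc, inner_smul_right,
    regularCoefficient, mul_assoc]

end Quotient

/-! ### Operator norms tested on a dense set -/

/-- The bound extends by continuity; then take `‖f‖ = 1` and `g = S f / ‖S f‖`. The arithmetic mean
of squares is what integrating over `y` produces directly. -/
theorem opNorm_le_of_norm_inner_le_on_dense {V : Type*} [NormedAddCommGroup V]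
    [InnerProductSpace ℂ V] {D : Set V} (hD : Dense D) {S : V →L[ℂ] V} {C : ℝ} (hC : 0 ≤ C)
    (h : ∀ f ∈ D, ∀ g ∈ D, ‖⟪g, S f⟫_ℂ‖ ≤ C * ((‖f‖ ^ 2 + ‖g‖ ^ 2) / 2)) : ‖S‖ ≤ C := by
  have hall : ∀ z : V × V, ‖⟪z.2, S z.1⟫_ℂ‖ ≤ C * ((‖z.1‖ ^ 2 + ‖z.2‖ ^ 2) / 2) := by
    have hcl : IsClosed {z : V × V | ‖⟪z.2, S z.1⟫_ℂ‖ ≤ C * ((‖z.1‖ ^ 2 + ‖z.2‖ ^ 2) / 2)} :=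
      isClosed_le (continuous_snd.inner (S.continuous.comp continuous_fst)).norm (by fun_prop)
    exact fun z => hcl.closure_subset_iff.2 (fun w hw => h w.1 hw.1 w.2 hw.2)
      ((hD.prod hD) z)
  refine ContinuousLinearMap.opNorm_le_of_unit_norm hC fun f hf => ?_
  by_cases h0 : S f = 0
  · simpa [h0] using hC
  have hn : (‖S f‖ : ℂ) ≠ 0 := by simpa using h0
  have h1 := hall (f, ((‖S f‖ : ℂ)⁻¹) • S f)
  simp only [inner_smul_left, norm_smul, norm_mul, hf, inner_self_eq_norm_sq_to_K, map_inv₀,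
    Complex.conj_ofReal, norm_inv, Complex.norm_real, norm_norm, norm_pow,
    Complex.coe_algebraMap] at h1
  have hn' : ‖S f‖ ≠ 0 := by simpa using h0
  have h2 : ‖S f‖⁻¹ * ‖S f‖ ^ 2 = ‖S f‖ := by field_simp
  rw [inv_mul_cancel₀ hn', h2] at h1
  linarith

theorem exists_inner_ne_zero_of_ne_zero {V : Type*} [NormedAddCommGroup V]
    [InnerProductSpace ℂ V] {D : Set V} (hD : Dense D) {S : V →L[ℂ] V} (hS : S ≠ 0) :
    ∃ ξ ∈ D, ∃ η ∈ D, ⟪η, S ξ⟫_ℂ ≠ 0 := by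
  by_contra! h
  refine hS (norm_le_zero_iff.1 (opNorm_le_of_norm_inner_le_on_dense hD le_rfl
    fun f hf g hg => ?_))
  simp [h f hf g hg]

/-! ### Faithfulness of the regular representation on measures -/

section Faithful

variable {G : Type*} [Group G] [TopologicalSpace G] [IsTopologicalGroup G]
  [LocallyCompactSpace G] [MeasurableSpace G] [BorelSpace G] [SecondCountableTopology G]
  {X : Type*} [MeasurableSpace X] {m : Measure X} {κ : X → ℂ}
  {p : X → G}

omit [SecondCountableTopology G] in
theorem eq_zero_of_forall_integral_conj_mul_eq_zero {ψ : G → ℂ} (hψ : Continuous ψ)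
    (h : ∀ g : G → ℂ, Continuous g → HasCompactSupport g →
      ∫ y, conj (g y) * ψ y ∂(Measure.haar : Measure G) = 0) (y₀ : G) : ψ y₀ = 0 := by
  by_contra hne
  -- Test against `g = b ψ`, with `b` a bump at `y₀`: the integral becomes `∫ b ‖ψ‖²`.
  obtain ⟨b, hb1, -, hbc, hb⟩ := exists_continuous_one_zero_of_isCompact
    (isCompact_singleton (x := y₀)) isClosed_empty (Set.disjoint_empty _)
  have hb1 : b y₀ = 1 := hb1 rfl
  have h0 := h (fun y => (b y : ℂ) * ψ y) (by fun_prop)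
    (HasCompactSupport.mul_right (hbc.comp_left (g := ((↑) : ℝ → ℂ)) (by simp)))
  have h1 : ∀ y, conj ((b y : ℂ) * ψ y) * ψ y = ((b y * ‖ψ y‖ ^ 2 : ℝ) : ℂ) := by
    intro y
    rw [map_mul, Complex.conj_ofReal, mul_assoc, Complex.conj_mul']
    push_cast
    rfl
  simp only [h1] at h0
  rw [integral_complex_ofReal, Complex.ofReal_eq_zero] at h0
  have hc : Continuous fun y => b y * ‖ψ y‖ ^ 2 := by fun_prop
  have hcs : HasCompactSupport fun y => b y * ‖ψ y‖ ^ 2 :=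
    HasCompactSupport.mul_right (f' := fun y => ‖ψ y‖ ^ 2) hbc
  have hnn : (0 : G → ℝ) ≤ fun y => b y * ‖ψ y‖ ^ 2 := fun y =>
    mul_nonneg (hb y).1 (sq_nonneg ‖ψ y‖)
  have hy₀ : b y₀ * ‖ψ y₀‖ ^ 2 ≠ 0 := by
    rw [hb1, one_mul]
    exact pow_ne_zero 2 (norm_ne_zero_iff.2 hne)
  exact (hc.integral_pos_of_hasCompactSupport_nonneg_nonzero hcs hnn hy₀).ne' h0

/-- With `f(t) = φ(t⁻¹)`, the integral is the value at `1` of `ψ(y) = ∫ κ(x) f(p(x)⁻¹ y)`. This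
function represents a zero vector and is continuous, so it vanishes at every point. -/
theorem integral_mul_comp_eq_zero [SFinite m] (hκ : Integrable κ m) (hp : Measurable p)
    (h : ∀ ξ : L2 G, ∫ x, κ x • leftRegular (p x) ξ ∂m = 0)
    {φ : G → ℂ} (hφ : Continuous φ) (hφc : HasCompactSupport φ) :
    ∫ x, κ x * φ (p x) ∂m = 0 := by
  set f : G → ℂ := fun t => φ t⁻¹ with hfdef
  have hf : Continuous f := by fun_prop
  have hfc : HasCompactSupport f := hφc.comp_homeomorph (Homeomorph.inv G)
  obtain ⟨C, hC⟩ := hφc.exists_bound_of_continuous hφ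
  have hfm : ∀ y, AEStronglyMeasurable (fun x => f ((p x)⁻¹ * y)) m := fun y =>
    (hf.stronglyMeasurable.comp_measurable (hp.inv.mul_const y)).aestronglyMeasurable
  set ψ : G → ℂ := fun y => ∫ x, κ x * f ((p x)⁻¹ * y) ∂m with hψdef
  have hψ : Continuous ψ := by
    refine continuous_of_dominated (bound := fun x => ‖κ x‖ * C)
      (fun y => hκ.aestronglyMeasurable.mul (hfm y))
      (fun y => Eventually.of_forall fun x => ?_) (hκ.norm.mul_const C)
      (Eventually.of_forall fun x => by fun_prop)
    rw [norm_mul]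
    exact mul_le_mul_of_nonneg_left (hC _) (norm_nonneg _)
  have hpair : ∀ g : G → ℂ, Continuous g → HasCompactSupport g →
      ∫ y, conj (g y) * ψ y ∂(Measure.haar : Measure G) = 0 := by
    intro g hg hgc
    have h0 := integral_inner (𝕜 := ℂ) (integrable_smul_leftRegular_comp hκ hp
      (vectorOfCompactSupport f hf hfc)) (vectorOfCompactSupport g hg hgc)
    rw [h, inner_zero_right] at h0
    simp only [inner_smul_right, inner_leftRegular_vectorOfCompactSupport,
      ← integral_const_mul] at h0
    have hgi : Integrable g (Measure.haar : Measure G) := hg.integrable_of_hasCompactSupport hgc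
    have hint : Integrable (fun z : X × G => κ z.1 * (conj (g z.2) * f ((p z.1)⁻¹ * z.2)))
        (m.prod Measure.haar) := by
      refine ((hκ.norm.mul_prod hgi.norm).mul_const C).mono'
        (hκ.aestronglyMeasurable.comp_fst.mul ?_) (Eventually.of_forall fun z => ?_)
      · refine StronglyMeasurable.aestronglyMeasurable (.mul ?_ ?_)
        · exact Continuous.stronglyMeasurable (f := fun y => conj (g y)) (by fun_prop)
            |>.comp_measurable measurable_snd
        · exact hf.stronglyMeasurable.comp_measurable
            ((hp.comp measurable_fst).inv.mul measurable_snd)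
      · rw [norm_mul, norm_mul, RCLike.norm_conj, ← mul_assoc]
        exact mul_le_mul_of_nonneg_left (hC _) (by positivity)
    rw [integral_integral_swap hint] at h0
    rw [← h0]
    refine integral_congr_ae (Eventually.of_forall fun y => ?_)
    simp only [hψdef, ← integral_const_mul]
    refine integral_congr_ae (Eventually.of_forall fun x => ?_)
    simp only
    ring
  have hψ1 : ∫ x, κ x * f ((p x)⁻¹ * 1) ∂m = 0 :=
    eq_zero_of_forall_integral_conj_mul_eq_zero hψ hpair 1
  simpa only [hfdef, mul_one, inv_inv] using hψ1

/-- The left regular representation is faithful on complex measures, tested on total mass. -/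
theorem integral_eq_zero_of_integral_smul_leftRegular [SFinite m] (hκ : Integrable κ m)
    (hp : Measurable p) (h : ∀ ξ : L2 G, ∫ x, κ x • leftRegular (p x) ξ ∂m = 0) :
    ∫ x, κ x ∂m = 0 := by
  -- Cutoffs equal to `1` on an exhaustion recover the total mass by dominated convergence.
  let K := CompactExhaustion.choice G
  choose φ hφ1 _ hφc hφ using fun n => exists_continuous_one_zero_of_isCompact
    (K.isCompact n) isClosed_empty (Set.disjoint_empty _)
  have hlim : Tendsto (fun n => ∫ x, κ x * (φ n (p x) : ℂ) ∂m) atTop (𝓝 (∫ x, κ x ∂m)) := by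
    refine tendsto_integral_of_dominated_convergence (fun x => ‖κ x‖) (fun n => ?_) hκ.norm
      (fun n => Eventually.of_forall fun x => ?_) (Eventually.of_forall fun x => ?_)
    · exact hκ.aestronglyMeasurable.mul
        ((Continuous.stronglyMeasurable (f := fun t => (φ n t : ℂ))
          (by fun_prop)).comp_measurable hp).aestronglyMeasurable
    · rw [norm_mul, Complex.norm_real, Real.norm_of_nonneg (hφ n _).1]
      exact mul_le_of_le_one_right (norm_nonneg _) (hφ n _).2
    · obtain ⟨N, hN⟩ := K.exists_mem (p x)
      refine tendsto_const_nhds.congr' ((eventually_ge_atTop N).mono fun n hn => ?_)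
      have : φ n (p x) = 1 := hφ1 n (K.subset hn hN)
      simp [this]
  have hz : ∀ n, ∫ x, κ x * (φ n (p x) : ℂ) ∂m = 0 := fun n =>
    integral_mul_comp_eq_zero hκ hp h (φ := fun t => (φ n t : ℂ)) (by fun_prop)
      ((hφc n).comp_left (g := ((↑) : ℝ → ℂ)) (by simp))
  simp only [hz] at hlim
  exact tendsto_nhds_unique hlim tendsto_const_nhds |>.symm ▸ rfl

end Faithful

/-! ### The norm estimate and the transfer to the quotient -/

section Quotient

variable {G Q : Type*} [Group G] [TopologicalSpace G] [IsTopologicalGroup G]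
  [LocallyCompactSpace G] [MeasurableSpace G] [BorelSpace G] [SecondCountableTopology G]
  [Group Q] [TopologicalSpace Q] [IsTopologicalGroup Q]
  [LocallyCompactSpace Q] [MeasurableSpace Q] [BorelSpace Q] [SecondCountableTopology Q]

/-- Two base measures occur because it is applied to `λ(μ) - λ(F)`, with `μ` a density against its
variation and `F` one against Haar measure. -/
theorem norm_le_of_regularCoefficient {q : G →* Q} (hq : Continuous q) {ξ η : L2 G}
    (hξ : ξ ∈ compactlySupportedVectors G) (hη : η ∈ compactlySupportedVectors G)
    {m₁ m₂ : Measure G} [SFinite m₁] [SFinite m₂] {k₁ k₂ : G → ℂ} (hk₁ : Integrable k₁ m₁)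
    (hk₂ : Integrable k₂ m₂) {T : L2 G →L[ℂ] L2 G} {S : L2 Q →L[ℂ] L2 Q}
    (hT : ∀ v, T v = ∫ s, k₁ s • leftRegular s v ∂m₁ - ∫ s, k₂ s • leftRegular s v ∂m₂)
    (hS : ∀ v, S v = ∫ s, (k₁ s * regularCoefficient ξ η s) • leftRegular (q s) v ∂m₁ -
      ∫ s, (k₂ s * regularCoefficient ξ η s) • leftRegular (q s) v ∂m₂) :
    ‖S‖ ≤ ‖T‖ * (‖ξ‖ ^ 2 + ‖η‖ ^ 2) := by
  refine opNorm_le_of_norm_inner_le_on_dense dense_compactlySupportedVectors (by positivity) ?_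
  rintro _ ⟨f, hf, hfc, rfl⟩ _ ⟨g, hg, hgc, rfl⟩
  obtain ⟨ξ, hξ, hξc, rfl⟩ := hξ
  obtain ⟨η, hη, hηc, rfl⟩ := hη
  obtain ⟨i₁, e₁⟩ := inner_integral_regularCoefficient hq hξ hξc hη hηc hf hfc hg hgc hk₁
  obtain ⟨i₂, e₂⟩ := inner_integral_regularCoefficient hq hξ hξc hη hηc hf hfc hg hgc hk₂
  obtain ⟨iξ, eξ⟩ := integrable_norm_sq_fiberVector hq hξ hξc hf hfc
  obtain ⟨iη, eη⟩ := integrable_norm_sq_fiberVector hq hη hηc hg hgc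
  rw [hS, inner_sub_right, ← e₁, ← e₂, ← integral_sub i₁ i₂]
  simp only [← inner_sub_right, ← hT]
  have hle : ∀ y, ‖⟪fiberVector hq hη hηc hg y, T (fiberVector hq hξ hξc hf y)⟫_ℂ‖ ≤
      ‖T‖ * ((‖fiberVector hq hξ hξc hf y‖ ^ 2 + ‖fiberVector hq hη hηc hg y‖ ^ 2) / 2) := by
    intro y
    refine (norm_inner_le_norm _ _).trans ?_
    have h1 := T.le_opNorm (fiberVector hq hξ hξc hf y)
    have h2 := mul_le_mul_of_nonneg_left h1 (norm_nonneg (fiberVector hq hη hηc hg y))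
    have h3 := mul_le_mul_of_nonneg_left (two_mul_le_add_sq ‖fiberVector hq hξ hξc hf y‖
      ‖fiberVector hq hη hηc hg y‖) (norm_nonneg T)
    linarith
  refine (norm_integral_le_of_norm_le (((iξ.add iη).div_const 2).const_mul ‖T‖)
    (Eventually.of_forall hle)).trans ?_
  simp only [Pi.add_apply]
  rw [integral_const_mul, integral_div, integral_add iξ iη, eξ, eη, mul_assoc]
  refine mul_le_mul_of_nonneg_left ?_ (norm_nonneg T)
  -- The cross terms `‖ξ‖²‖g‖²` and `‖η‖²‖f‖²` are added to reach the product form.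
  nlinarith [mul_nonneg (sq_nonneg ‖vectorOfCompactSupport ξ hξ hξc‖)
      (sq_nonneg ‖vectorOfCompactSupport g hg hgc‖),
    mul_nonneg (sq_nonneg ‖vectorOfCompactSupport η hη hηc‖)
      (sq_nonneg ‖vectorOfCompactSupport f hf hfc‖)]

theorem zero_mem_image_inter_reducedCStar (E : Set G) :
    (0 : L2 G →L[ℂ] L2 G) ∈ leftRegularMeasure '' measuresOn E ∩ reducedCStar G := by
  refine ⟨⟨0, by simp [measuresOn], ?_⟩, subset_closure ⟨0, ?_⟩⟩
  · ext1 ξ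
    simp [leftRegularMeasure_apply]
  · ext1 ξ
    rw [leftRegularL1_apply]
    refine integral_eq_zero_of_ae ?_
    filter_upwards [Lp.coeFn_zero ℂ 1 (Measure.haar : Measure G)] with s hs
    rw [hs]
    simp

theorem meetsTrivially_iff {E : Set G} :
    MeetsTrivially E ↔ ∀ μ ∈ measuresOn E, leftRegularMeasure μ ∈ reducedCStar G →
      leftRegularMeasure μ = 0 := by
  constructor
  · intro h μ hμ hC
    have : leftRegularMeasure μ ∈ leftRegularMeasure '' measuresOn E ∩ reducedCStar G :=
      ⟨⟨μ, hμ, rfl⟩, hC⟩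
    rw [MeetsTrivially] at h
    rwa [h] at this
  · intro h
    refine Set.eq_singleton_iff_unique_mem.2 ⟨zero_mem_image_inter_reducedCStar E, ?_⟩
    rintro _ ⟨⟨μ, hμ, rfl⟩, hC⟩
    exact h μ hμ hC

theorem exists_withDensityᵥ_variation_eq {X : Type*} [MeasurableSpace X] (μ : ComplexMeasure X) :
    ∃ k : X → ℂ, Integrable k μ.variation ∧ μ.variation.withDensityᵥ k = μ := by
  have := ComplexMeasure.isFiniteMeasure_variation μ
  refine ⟨_, MeasureTheory.ComplexMeasure.integrable_rnDeriv μ _,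
    ComplexMeasure.withDensityᵥ_rnDeriv_eq μ μ.variation
      (VectorMeasure.AbsolutelyContinuous.mk fun A hA h0 => ?_)⟩
  rw [Measure.toENNRealVectorMeasure_apply_measurable hA] at h0
  have := VectorMeasure.enorm_measure_le_variation μ A
  simpa [h0] using this

omit [IsTopologicalGroup G] [LocallyCompactSpace G] [IsTopologicalGroup Q]
  [LocallyCompactSpace Q] [SecondCountableTopology Q] in
theorem map_withDensityᵥ_mem_measuresOn {q : G →* Q} (hq : Continuous q) {E : Set Q}
    (hE : IsClosed E) {m : Measure G} (hm : m.support ⊆ q ⁻¹' E) {k : G → ℂ}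
    (hk : Integrable k m) : (m.withDensityᵥ k).map q ∈ measuresOn E := by
  refine Measure.support_subset_of_isClosed hE ?_
  rw [mem_ae_iff, ← nonpos_iff_eq_zero]
  refine (VectorMeasure.variation_map_le Eᶜ).trans ?_
  rw [Measure.map_apply hq.measurable hE.measurableSet.compl, Measure.variation_withDensityᵥ hk,
    Set.preimage_compl, withDensity_absolutelyContinuous m _ (measure_mono_null
      (Set.compl_subset_compl.2 hm) Measure.measure_compl_support)]

/-- Preimages under quotient maps preserve `MeetsTrivially`, for arbitrary locally compact second
countable groups. If `λ(μ) ≠ 0` lies in `C*_r(G)`, choose a coefficient `u` of `λ` with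
`∫ u dμ ≠ 0`; then `λ(q_*(u μ))` is a nonzero element of `C*_r(Q)`. Multiplying by `u` replaces
amenability: it makes `λ(μ) ↦ λ(q_*(u μ))` bounded (`norm_le_of_regularCoefficient`). -/
theorem MeetsTrivially.preimage {q : G →* Q} (hq : Continuous q) (hs : Function.Surjective q)
    {E : Set Q} (hE : IsClosed E) (h : MeetsTrivially E) : MeetsTrivially (q ⁻¹' E) := by
  rw [meetsTrivially_iff] at h ⊢
  intro μ hμ hC
  by_contra hne
  have := ComplexMeasure.isFiniteMeasure_variation μ
  obtain ⟨ξ, hξ, η, hη, hξη⟩ :=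
    exists_inner_ne_zero_of_ne_zero dense_compactlySupportedVectors hne
  obtain ⟨k, hk, hkμ⟩ := exists_withDensityᵥ_variation_eq μ
  have hku := integrable_mul_regularCoefficient hk ξ η
  have hμv : ∀ v, leftRegularMeasure μ v = ∫ s, k s • leftRegular s v ∂μ.variation := by
    intro v
    conv_lhs => rw [← hkμ]
    exact leftRegularMeasure_withDensityᵥ hk v
  set ν := (μ.variation.withDensityᵥ fun s => k s * regularCoefficient ξ η s).map q
  have hν := leftRegularMeasure_map_withDensityᵥ hku hq.measurable
  have hνC : leftRegularMeasure ν ∈ reducedCStar Q := by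
    rw [reducedCStar, Metric.mem_closure_iff] at hC ⊢
    intro ε hε
    -- The `+ 1` makes the divisor positive whatever `ξ` and `η` are.
    have hpos : 0 < ‖ξ‖ ^ 2 + ‖η‖ ^ 2 + 1 := by positivity
    obtain ⟨_, ⟨F, rfl⟩, hF⟩ := hC (ε / (‖ξ‖ ^ 2 + ‖η‖ ^ 2 + 1)) (by positivity)
    have hFi := L1.integrable_coeFn F
    obtain ⟨F', hF'⟩ := exists_leftRegularL1_eq_map hq hs
      (integrable_mul_regularCoefficient hFi ξ η)
    refine ⟨_, ⟨F', rfl⟩, ?_⟩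
    have hle := norm_le_of_regularCoefficient hq hξ hη hk hFi
      (T := leftRegularMeasure μ - leftRegularL1 F) (S := leftRegularMeasure ν - leftRegularL1 F')
      (fun v => by rw [sub_apply, hμv, leftRegularL1_apply])
      (fun v => by rw [sub_apply, hν, hF'])
    rw [dist_eq_norm] at hF ⊢
    rw [lt_div_iff₀ hpos] at hF
    refine lt_of_le_of_lt (hle.trans ?_) hF
    exact mul_le_mul_of_nonneg_left (by linarith) (norm_nonneg _)
  have hν0 := h ν (map_withDensityᵥ_mem_measuresOn hq hE hμ hku) hνC
  -- The total mass of `ν` is `∫ u dμ = ⟨η, λ(μ) ξ⟩`, nonzero by the choice of `ξ` and `η`.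
  have hmass := integral_eq_zero_of_integral_smul_leftRegular hku hq.measurable
    (fun v => by rw [← hν, hν0, zero_apply])
  apply hξη
  rw [hμv, ← integral_inner (𝕜 := ℂ) (integrable_smul_leftRegular_comp hk (p := fun s => s)
    measurable_id ξ), ← hmass]
  simp only [inner_smul_right, regularCoefficient]

end Quotient

end HarmonicAnalysis

theorem theorem3p7 {G : Type*} [Group G] [TopologicalSpace G] [IsTopologicalGroup G] [T2Space G]
    [LocallyCompactSpace G] [SecondCountableTopology G]
    (hG : (∀ a b : G, a * b = b * a) ∨ CompactSpace G)
    (H : Subgroup G) [H.Normal] (hH : IsClosed (H : Set G))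
    (E : Set (G ⧸ H)) (hE : IsClosed E)
    (hM0 : HarmonicAnalysis.IsM0Set ((QuotientGroup.mk : G → G ⧸ H) ⁻¹' E)) :
    HarmonicAnalysis.IsM0Set E := by
  refine ⟨hE, fun hU => hM0.2 ⟨hM0.1, ?_⟩⟩
  let _ : MeasurableSpace G := borel G
  have : BorelSpace G := ⟨rfl⟩
  let _ : MeasurableSpace (G ⧸ H) := borel (G ⧸ H)
  have : BorelSpace (G ⧸ H) := ⟨rfl⟩
  exact HarmonicAnalysis.MeetsTrivially.preimage (q := QuotientGroup.mk' H)
    QuotientGroup.continuous_mk (QuotientGroup.mk'_surjective H) hE hU.2
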